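/- Let $n\ge 1$ and let $MA(n,\mathbb C)$ (resp. $GA(n,\mathbb C)$) be the set of affine maps (resp. invertible affine maps) $f(x)=Ax+a$ of $\mathbb C^n$; for such an $f$ put $\Phi(f)=\begin{bmatrix}1&0\\ a&A\end{bmatrix}\in M_{n+1}(\mathbb C)$. For $m\ge 1$ let $\mathbb T_m(\mathbb C)$ be the set of lower triangular $m\times m$ complex matrices whose diagonal entries are all equal, and for $\eta=(n_1,\dots,n_r)$ with integers $n_i\ge 1$ and $n_1+\dots+n_r=n+1$ let $\mathcal K_{\eta,r}(\mathbb C)=\mathbb T_{n_1}(\mathbb C)\oplus\dots\oplus\mathbb T_{n_r}(\mathbb C)$ be the corresponding set of block diagonal matrices (so $1\le r\le n+1$). Let $\mathcal G$ be an abelian sub-semigroup of $MA(n,\mathbb C)$ under composition, and let $P\in\Phi(GA(n,\mathbb C))$ be such that $P^{-1}\Phi(\mathcal G)P\subset\mathcal K_{\eta,r}(\mathbb C)$. If $\mathcal G$ is generated (as a semigroup, as a semigroup with identity, or as a group) by $2n-r+1$ commuting invertible affine maps, then $\mathcal G$ has no dense orbit: for every $v\in\mathbb C^n$ the set $\mathcal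 G(v)=\{f(v): f\in\mathcal G\}$ is not dense in $\mathbb C^n$. -/

import Mathlib

namespace AbelianAffine

/-- `MA(n, ℂ)`: the affine maps `x ↦ A x + a` of `ℂⁿ`, a monoid under composition. -/
abbrev MA (n : ℕ) : Type := (Fin n → ℂ) →ᵃ[ℂ] (Fin n → ℂ)

/-- `GA(n, ℂ)`: the group of invertible affine maps of `ℂⁿ`. -/
abbrev GA (n : ℕ) : Type := (Fin n → ℂ) ≃ᵃ[ℂ] (Fin n → ℂ)

/-- For `f = (A, a)`, that is `f x = A x + a`, the `(n+1) × (n+1)` matrix with block rows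
`(1, 0)` and `(a, A)`. Here `a = f 0` and `A` is the matrix of the linear part of `f`. -/
noncomputable def Phi {n : ℕ} (f : MA n) : Matrix (Fin (n + 1)) (Fin (n + 1)) ℂ :=
  Matrix.of (Fin.cons (Fin.cons 1 0)
    (fun i => Fin.cons (f 0 i) (LinearMap.toMatrix' f.linear i)))

/-- `𝕋_m(ℂ)`: lower triangular `m × m` matrices with all diagonal entries equal. -/
def T (m : ℕ) : Set (Matrix (Fin m) (Fin m) ℂ) :=
  {M | (∀ i j, i < j → M i j = 0) ∧ ∃ μ : ℂ, ∀ i, M i i = μ}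

/-- `𝒦_{η,r}(ℂ) = 𝕋_{n₁}(ℂ) ⊕ ⋯ ⊕ 𝕋_{n_r}(ℂ)`, block diagonal matrices of order `N`, for
`η = (n₁, …, n_r)` a tuple of positive integers with sum `N` (a composition of `N`); its
length is `r`. The blocks are placed consecutively. -/
def K {N : ℕ} (η : Composition N) : Set (Matrix (Fin N) (Fin N) ℂ) :=
  {M | ∃ B : (k : Fin η.length) → Matrix (Fin (η.blocksFun k)) (Fin (η.blocksFun k)) ℂ,
    (∀ k, B k ∈ T (η.blocksFun k)) ∧
      M = Matrix.reindex η.blocksFinEquiv η.blocksFinEquiv (Matrix.blockDiagonal' B)}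

/-- The semigroup `𝒢` of affine maps is generated by the invertible affine maps `f k`: either
as a semigroup, or as a semigroup with identity, or as a group. -/
def IsGeneratedBy {n p : ℕ} (𝒢 : Subsemigroup (MA n)) (f : Fin p → GA n) : Prop :=
  𝒢 = Subsemigroup.closure (Set.range fun k => ((f k : GA n) : MA n)) ∨
  𝒢 = (Submonoid.closure (Set.range fun k => ((f k : GA n) : MA n))).toSubsemigroup ∨
  (𝒢 : Set (MA n)) =
    (fun g : GA n => (g : MA n)) '' (Subgroup.closure (Set.range f) : Set (GA n))

/-- The orbit `𝒢(v) = {g(v) : g ∈ 𝒢}`. -/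
def orbit {n : ℕ} (𝒢 : Subsemigroup (MA n)) (v : Fin n → ℂ) : Set (Fin n → ℂ) :=
  {x | ∃ g ∈ 𝒢, g v = x}

end AbelianAffine

/-! Conjugating by `P` and embedding `ℂⁿ` as the hyperplane `x 0 = 1` turns `𝒢` into a commuting set
`S` of block triangular matrices. A dense orbit makes its vector `w` cyclic for the algebra `D`
generated by `S`. Hence `D` is its own commutant, contains the block scalar matrices, and `M ↦ M *ᵥ
w` identifies it with `ℂⁿ⁺¹`; so `S` is dense in the matrices of `D` with top left entry 1.

On invertible elements of `D`, `reLog` (log of the moduli of the eigenvalues plus log of the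
unipotent part) turns products into sums. When the top left entry is 1 its values lie in a real
space of dimension `2(n+1) - (r+1)`, exactly the number of generators. Some real linear form,
nonzero on that space, is therefore integral on the generators (`exists_linearForm_integral`), hence
on `S`, and by density on the whole slice. Continuity along curves through 1 then forces the form to
vanish (`linearForm_eq_zero_of_integral_reLog`), a contradiction. -/

/-- The logarithm series truncated after `m` terms; on elements with `z ^ m = 0` it is the
logarithm of `1 + z`. -/
noncomputable def nilLog (𝕜 : Type*) {A : Type*} [Field 𝕜] [CommRing A] [Algebra 𝕜 A] (m : ℕ)
    (z : A) : A :=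
  ∑ k ∈ Finset.range m, ((-1) ^ k / ((k : 𝕜) + 1)) • z ^ (k + 1)

/-! ### Logarithm of unipotent elements. -/

section NilLog

variable {𝕜 A B : Type*} [Field 𝕜] [CommRing A] [Algebra 𝕜 A] [CommRing B] [Algebra 𝕜 B]

theorem nilLog_zero (m : ℕ) : nilLog 𝕜 m (0 : A) = 0 := by
  simp [nilLog]

theorem map_nilLog (φ : A →ₐ[𝕜] B) (m : ℕ) (z : A) :
    φ (nilLog 𝕜 m z) = nilLog 𝕜 m (φ z) := by
  simp [nilLog]

-- Termwise differentiation gives the geometric sum of `-z`, which `1 + z` inverts because `z` is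
-- nilpotent.
open Polynomial in
theorem one_add_mul_derivative_nilLog [CharZero 𝕜] {m : ℕ} {z : A[X]} (hz : z ^ m = 0) :
    (1 + z) * derivative (nilLog 𝕜 m z) = derivative z := by
  have h : derivative (nilLog 𝕜 m z) = (∑ k ∈ Finset.range m, (-z) ^ k) * derivative z := by
    rw [nilLog, derivative_sum, Finset.sum_mul]
    refine Finset.sum_congr rfl fun k _ => ?_
    have hk : (k : 𝕜) + 1 ≠ 0 := by exact_mod_cast k.succ_ne_zero
    rw [derivative_smul, derivative_pow_succ, neg_pow z k]
    have h1 : (C ((k : A) + 1) : A[X]) = algebraMap 𝕜 A[X] ((k : 𝕜) + 1) := by simp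
    have h2 : ((-1 : A[X]) ^ k) = algebraMap 𝕜 A[X] ((-1) ^ k) := by simp
    rw [h1, h2, Algebra.smul_def, ← mul_assoc, ← mul_assoc, ← map_mul, div_mul_cancel₀ _ hk]
  have hg := mul_neg_geom_sum (-z) m
  rw [neg_pow, hz, mul_zero, sub_zero, sub_neg_eq_add] at hg
  rw [h, ← mul_assoc, hg, one_mul]

open Polynomial in
/-- `log ((1 + x) (1 + y)) = log (1 + x) + log (1 + y)` for nilpotent `x` and `y`. -/
theorem nilLog_mul [CharZero 𝕜] {m : ℕ} {x y : A} (hx : x ^ m = 0) (hy : y ^ m = 0) :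
    nilLog 𝕜 (2 * m) (x + y + x * y) = nilLog 𝕜 (2 * m) x + nilLog 𝕜 (2 * m) y := by
  have hu : (C x * X : A[X]) ^ m = 0 := by rw [mul_pow, ← C_pow, hx, C_0, zero_mul]
  have hv : (C y * X : A[X]) ^ m = 0 := by rw [mul_pow, ← C_pow, hy, C_0, zero_mul]
  set u : A[X] := C x * X with hu_def
  set v : A[X] := C y * X with hv_def
  -- Doubling the truncation order leaves room for the nilpotency index of `u + v + u * v`.
  have hw : (u + v + u * v) ^ (2 * m) = 0 := by
    have : u + v + u * v = u + v * (1 + u) := by ring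
    rw [this]
    refine (Commute.all _ _).add_pow_eq_zero_of_add_le_succ_of_pow_eq_zero hu
      (n := m) (by rw [mul_pow, hv, zero_mul]) (by omega)
  have hu2 : u ^ (2 * m) = 0 := pow_eq_zero_of_le (by omega) hu
  have hv2 : v ^ (2 * m) = 0 := pow_eq_zero_of_le (by omega) hv
  -- The defect for `x * X`, `y * X` has zero derivative, so it is constant; comparing its values at
  -- 0 and 1 gives the identity.
  set L : A[X] := nilLog 𝕜 (2 * m) (u + v + u * v) - nilLog 𝕜 (2 * m) u - nilLog 𝕜 (2 * m) v
    with hL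
  have hD : (1 + (u + v + u * v)) * derivative L = 0 := by
    have h1 := one_add_mul_derivative_nilLog (𝕜 := 𝕜) hw
    have h2 := one_add_mul_derivative_nilLog (𝕜 := 𝕜) hu2
    have h3 := one_add_mul_derivative_nilLog (𝕜 := 𝕜) hv2
    have h4 : derivative (u + v + u * v)
        = derivative u + derivative v + (derivative u * v + u * derivative v) := by simp
    rw [hL, derivative_sub, derivative_sub]
    linear_combination h1 + h4 - (1 + v) * h2 - (1 + u) * h3
  have hunit : IsUnit (1 + (u + v + u * v)) := IsNilpotent.isUnit_one_add ⟨_, hw⟩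
  have hD0 : derivative L = 0 := (hunit.mul_right_eq_zero).1 hD
  have : IsAddTorsionFree A := IsAddTorsionFree.of_isTorsionFree 𝕜 A
  have hdeg := derivative_eq_zero.1 hD0
  have heval (t : A) : L.eval t = nilLog 𝕜 (2 * m) (x * t + y * t + x * t * (y * t))
      - nilLog 𝕜 (2 * m) (x * t) - nilLog 𝕜 (2 * m) (y * t) := by
    have h (z : A[X]) : (nilLog 𝕜 (2 * m) z).eval t = nilLog 𝕜 (2 * m) (z.eval t) := by
      simp [nilLog, eval_finsetSum]
    simp [hL, h, hu_def, hv_def]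
  rw [eq_C_of_natDegree_eq_zero hdeg] at heval
  have h0 := heval 0
  have h1 := heval 1
  simp only [eval_C, mul_zero, add_zero, nilLog_zero, sub_zero, mul_one] at h0 h1
  rw [h0] at h1
  linear_combination -h1

end NilLog

/-- In a real vector space of dimension `p ≥ 1`, some nonzero linear form takes integer values on
`p` given vectors. -/
theorem exists_linearForm_integral {V : Type*} [AddCommGroup V] [Module ℝ V]
    (W : Submodule ℝ V) {p : ℕ} (hp : 0 < p) (hW : Module.finrank ℝ W = p) (b : Fin p → V)
    (hb : ∀ k, b k ∈ W) :
    ∃ ψ : V →ₗ[ℝ] ℝ, (∀ k, ∃ m : ℤ, ψ (b k) = m) ∧ ∃ w ∈ W, ψ w ≠ 0 := by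
  have : FiniteDimensional ℝ W := Module.finite_of_finrank_pos (by omega)
  have : Nonempty (Fin p) := ⟨⟨0, hp⟩⟩
  let c : Fin p → W := fun k => ⟨b k, hb k⟩
  obtain ⟨ψ, h1, w, h2⟩ : ∃ ψ : W →ₗ[ℝ] ℝ, (∀ k, ∃ m : ℤ, ψ (c k) = m) ∧ ∃ w, ψ w ≠ 0 := by
    -- Independent vectors form a basis, and a coordinate form works; otherwise some nonzero form
    -- vanishes on their proper span.
    by_cases hc : LinearIndependent ℝ c
    · let B := basisOfLinearIndependentOfCardEqFinrank hc (by simp [hW])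
      have hB (k) : B k = c k := by simp [B]
      refine ⟨B.coord ⟨0, hp⟩, fun k => ?_, B ⟨0, hp⟩, by simp⟩
      rw [← hB, B.coord_apply, B.repr_self, Finsupp.single_apply]
      split_ifs
      · exact ⟨1, by simp⟩
      · exact ⟨0, by simp⟩
    · have hs : Submodule.span ℝ (Set.range c) < ⊤ := by
        rw [lt_top_iff_ne_top]
        intro h
        exact hc (linearIndependent_of_top_le_span_of_card_eq_finrank h.ge (by simp [hW]))
      obtain ⟨ψ, hψ, hle⟩ := Submodule.exists_le_ker_of_lt_top _ hs
      refine ⟨ψ, fun k => ⟨0, ?_⟩, ?_⟩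
      · simpa using hle (Submodule.subset_span ⟨k, rfl⟩)
      · by_contra! h
        exact hψ (LinearMap.ext h)
  obtain ⟨g, hg⟩ := LinearMap.exists_extend ψ
  have hg' (x : W) : g x = ψ x := by rw [← hg]; rfl
  exact ⟨g, fun k => by simpa [← hg' (c k)] using h1 k, w, w.2, by rwa [hg']⟩

/-! ### Real logarithm on a split commutative algebra. -/

section SplitAlgebra

variable {A ι : Type*} [CommRing A] [Algebra ℂ A]

/-- If the spectrum map `Λ : A → ℂ^ι` has the section `s`, the nonzero values of `Λ a` split `a` as
the product of `s (Λ a)` and a unipotent element; this is the sum of the real part of the logarithm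
of the first factor and of the logarithm of the second one. -/
noncomputable def reLog (Λ : A →ₐ[ℂ] (ι → ℂ)) (s : (ι → ℂ) →ₐ[ℂ] A) (m : ℕ) (a : A) : A :=
  s (fun i => (Real.log ‖Λ a i‖ : ℂ)) + nilLog ℝ (2 * m) (a * s (Λ a)⁻¹ - 1)

variable {Λ : A →ₐ[ℂ] (ι → ℂ)} {s : (ι → ℂ) →ₐ[ℂ] A} {m : ℕ}

theorem map_unipotentPart_sub_one (hs : ∀ c, Λ (s c) = c) {a : A} (ha : ∀ i, Λ a i ≠ 0) :
    Λ (a * s (Λ a)⁻¹ - 1) = 0 := by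
  ext i
  simp [hs, ha i]

theorem reLog_mul (hs : ∀ c, Λ (s c) = c) (hnil : ∀ x, Λ x = 0 → x ^ m = 0) {a b : A}
    (ha : ∀ i, Λ a i ≠ 0) (hb : ∀ i, Λ b i ≠ 0) :
    reLog Λ s m (a * b) = reLog Λ s m a + reLog Λ s m b := by
  have h1 : (fun i => (Real.log ‖Λ (a * b) i‖ : ℂ))
      = (fun i => (Real.log ‖Λ a i‖ : ℂ)) + fun i => (Real.log ‖Λ b i‖ : ℂ) := by
    ext i
    simp [Real.log_mul, ha i, hb i]
  have h2 := nilLog_mul (𝕜 := ℝ) (hnil _ (map_unipotentPart_sub_one hs ha))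
    (hnil _ (map_unipotentPart_sub_one hs hb))
  have h3 : a * b * s (Λ (a * b))⁻¹ - 1 = (a * s (Λ a)⁻¹ - 1) + (b * s (Λ b)⁻¹ - 1)
      + (a * s (Λ a)⁻¹ - 1) * (b * s (Λ b)⁻¹ - 1) := by
    rw [map_mul, mul_inv, map_mul]
    ring
  rw [reLog, h1, h3, h2, map_add, reLog, reLog]
  abel

/-- The real subspace in which `reLog` takes its values on the elements `a` with `Λ a k = 1`. -/
noncomputable def logSpace (Λ : A →ₐ[ℂ] (ι → ℂ)) (k : ι) : Submodule ℝ A :=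
  LinearMap.ker (LinearMap.prod
    (LinearMap.pi fun i => Complex.imLm ∘ₗ LinearMap.proj i ∘ₗ Λ.toLinearMap.restrictScalars ℝ)
    (Complex.reLm ∘ₗ LinearMap.proj k ∘ₗ Λ.toLinearMap.restrictScalars ℝ))

theorem mem_logSpace {k : ι} {a : A} :
    a ∈ logSpace Λ k ↔ (∀ i, (Λ a i).im = 0) ∧ (Λ a k).re = 0 := by
  simp [logSpace, funext_iff]

/-- Rank-nullity: the section `s` makes the `card ι + 1` defining real conditions independent. -/
theorem finrank_logSpace [FiniteDimensional ℂ A] [Fintype ι] (hs : ∀ c, Λ (s c) = c) (k : ι) :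
    Module.finrank ℝ (logSpace Λ k) + (Fintype.card ι + 1) = 2 * Module.finrank ℂ A := by
  classical
  have : FiniteDimensional ℝ A := Module.Finite.trans ℂ A
  rw [← finrank_real_of_complex, logSpace, add_comm]
  refine Eq.trans ?_ (LinearMap.finrank_range_add_finrank_ker (LinearMap.prod
    (LinearMap.pi fun i => Complex.imLm ∘ₗ LinearMap.proj i ∘ₗ Λ.toLinearMap.restrictScalars ℝ)
    (Complex.reLm ∘ₗ LinearMap.proj k ∘ₗ Λ.toLinearMap.restrictScalars ℝ)))
  rw [LinearMap.range_eq_top.2, finrank_top]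
  · simp
  · rintro ⟨c, d⟩
    refine ⟨s fun i => ⟨if i = k then d else 0, c i⟩, ?_⟩
    ext <;> simp [hs]

theorem reLog_mem_logSpace (hs : ∀ c, Λ (s c) = c) {k : ι} {a : A}
    (ha : ∀ i, Λ a i ≠ 0) (hk : Λ a k = 1) : reLog Λ s m a ∈ logSpace Λ k := by
  have : Λ (reLog Λ s m a) = fun i => (Real.log ‖Λ a i‖ : ℂ) := by
    have h := map_nilLog (Λ.restrictScalars ℝ) (2 * m) (a * s (Λ a)⁻¹ - 1)
    simp only [AlgHom.restrictScalars_apply, map_unipotentPart_sub_one hs ha, nilLog_zero] at h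
    rw [reLog, map_add, hs, h, add_zero]
  rw [mem_logSpace, this]
  simp [hk]

theorem reLog_exp_mul (hs : ∀ c, Λ (s c) = c) (c : ι → ℝ) {ν : A} (hν : Λ ν = 0) :
    reLog Λ s m (s (fun i => (Real.exp (c i) : ℂ)) * (1 + ν))
      = s (fun i => (c i : ℂ)) + nilLog ℝ (2 * m) ν := by
  have h : Λ (s (fun i => (Real.exp (c i) : ℂ)) * (1 + ν)) = fun i => (Real.exp (c i) : ℂ) := by
    simp [hs, hν]
  have h2 : s (fun i => (Real.exp (c i) : ℂ)) * s (fun i => (Real.exp (c i) : ℂ))⁻¹ = 1 := by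
    rw [← map_mul, ← map_one s]
    congr 1
    ext i
    simp
  have h3 : s (fun i => (Real.exp (c i) : ℂ)) * (1 + ν) * s (fun i => (Real.exp (c i) : ℂ))⁻¹ - 1
      = ν := by linear_combination (1 + ν) * h2
  rw [reLog, h, h3]
  congr 3
  ext i
  simp only [Complex.norm_real, Real.norm_eq_abs, Real.abs_exp, Real.log_exp]

/-- A real linear form which is integral on the values of `reLog` at all `a` with `Λ a k = 1` and
`Λ a` invertible vanishes on `logSpace`. -/
theorem linearForm_eq_zero_of_integral_reLog (hs : ∀ c, Λ (s c) = c)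
    (hm : 0 < m) {k : ι} (ψ : A →ₗ[ℝ] ℝ)
    (hψ : ∀ a, (∀ i, Λ a i ≠ 0) → Λ a k = 1 → ∃ z : ℤ, ψ (reLog Λ s m a) = z) {w : A}
    (hw : w ∈ logSpace Λ k) : ψ w = 0 := by
  obtain ⟨him, hre⟩ := mem_logSpace.1 hw
  set c : ι → ℝ := fun i => (Λ w i).re with hc
  have hΛ : Λ w = fun i => (c i : ℂ) := by
    ext i
    exact Complex.ext (by simp [hc]) (by simp [him])
  set ν : A := w - s (fun i => (c i : ℂ)) with hν
  have hν0 : Λ ν = 0 := by rw [hν, map_sub, hs, hΛ, sub_self]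
  -- This is `ψ ∘ reLog` along the curve `s (exp (t c)) * (1 + t ν)`: a polynomial in `t` with
  -- integer values, hence constant.
  let g : ℝ → ℝ := fun t => t * ψ (s fun i => (c i : ℂ)) +
    ∑ j ∈ Finset.range (2 * m), (((-1) ^ j / ((j : ℝ) + 1)) * t ^ (j + 1)) * ψ (ν ^ (j + 1))
  have hg (t : ℝ) : ∃ z : ℤ, g t = z := by
    have h := reLog_exp_mul (m := m) hs (fun i => t * c i) (ν := (t : ℝ) • ν)
      (by rw [← Complex.coe_smul, map_smul, hν0, smul_zero])
    have h1 : g t = ψ (s (fun i => ((t * c i : ℝ) : ℂ)) + nilLog ℝ (2 * m) (t • ν)) := by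
      have h2 : s (fun i => ((t * c i : ℝ) : ℂ)) = t • s (fun i => (c i : ℂ)) := by
        rw [← Complex.coe_smul, ← map_smul]
        congr 1
        ext i
        simp
      simp only [g, h2, nilLog, map_add, map_smul, map_sum, smul_pow, smul_eq_mul, mul_assoc]
    rw [h1, ← h]
    have hΛa : Λ (s (fun i => (Real.exp (t * c i) : ℂ)) * (1 + t • ν))
        = fun i => (Real.exp (t * c i) : ℂ) := by
      rw [← Complex.coe_smul, map_mul, hs, map_add, map_smul, hν0, smul_zero, add_zero, map_one,
        mul_one]
    refine hψ _ (fun i => ?_) ?_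
    · rw [hΛa]
      exact Complex.ofReal_ne_zero.2 (Real.exp_pos _).ne'
    · rw [hΛa]
      simp [hc, hre]
  have hgc : Continuous g := by fun_prop
  choose z hz using hg
  have hzc : Continuous z := by
    rw [Int.isClosedEmbedding_coe_real.isEmbedding.continuous_iff]
    exact hgc.congr hz
  have hconst (t : ℝ) : g t = g 0 := by
    rw [hz, hz, PreconnectedSpace.constant inferInstance hzc (y := 0)]
  have hd0 : HasDerivAt g 0 0 := by
    rw [show g = fun _ => g 0 from funext hconst]
    exact hasDerivAt_const _ _
  have hd1 : HasDerivAt g (1 * ψ (s fun i => (c i : ℂ)) + ∑ j ∈ Finset.range (2 * m),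
      (((-1) ^ j / ((j : ℝ) + 1)) * (((j + 1 : ℕ) : ℝ) * 0 ^ j)) * ψ (ν ^ (j + 1))) 0 := by
    refine ((hasDerivAt_id (0 : ℝ)).mul_const _).add (HasDerivAt.fun_sum fun j _ => ?_)
    exact ((hasDerivAt_pow (j + 1) (0 : ℝ)).const_mul _).mul_const _
  have := hd1.unique hd0
  -- At `t = 0` only the linear term survives, so the derivative is `ψ (s c) + ψ ν = ψ w`.
  rw [Finset.sum_eq_single_of_mem 0 (by simpa using hm)
    (fun j _ hj => by simp [zero_pow hj])] at this
  simpa [hν] using this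

variable [TopologicalSpace A] [IsTopologicalRing A] [ContinuousSMul ℂ A] [T2Space A]
  [FiniteDimensional ℂ A] [Finite ι]

theorem continuousOn_reLog :
    ContinuousOn (reLog Λ s m) {a | ∀ i, Λ a i ≠ 0} := by
  have : ContinuousSMul ℝ A := IsScalarTower.continuousSMul ℂ
  have hΛ (i : ι) : Continuous fun a => Λ a i :=
    (continuous_apply i).comp (Λ.toLinearMap.continuous_of_finiteDimensional)
  have hs : Continuous s := s.toLinearMap.continuous_of_finiteDimensional
  have hl : Continuous fun z : A => nilLog ℝ (2 * m) z := by
    unfold nilLog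
    fun_prop
  refine ContinuousOn.add (hs.comp_continuousOn (continuousOn_pi.2 fun i => ?_))
    (hl.comp_continuousOn ((continuousOn_id.mul (hs.comp_continuousOn
      (continuousOn_pi.2 fun i => ?_))).sub continuousOn_const))
  · exact Complex.continuous_ofReal.comp_continuousOn
      (ContinuousOn.log (hΛ i).norm.continuousOn fun a ha => norm_ne_zero_iff.2 (ha i))
  · exact (hΛ i).continuousOn.inv₀ fun a ha => ha i

/-- Elements of `{a | Λ a k = 1}` on which a suitable homomorphism to `ℝ`, integral at the given
elements `b j`, takes integer values are not dense there. -/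
theorem exists_hom_integral_not_dense (hs : ∀ c, Λ (s c) = c)
    (hnil : ∀ x, Λ x = 0 → x ^ m = 0) (hm : 0 < m) (k : ι) {p : ℕ} (hp : 0 < p)
    (hcard : p + (Nat.card ι + 1) = 2 * Module.finrank ℂ A) (b : Fin p → A)
    (hb : ∀ j i, Λ (b j) i ≠ 0) (hbk : ∀ j, Λ (b j) k = 1) :
    ∃ θ : A → ℝ, (∀ a a', (∀ i, Λ a i ≠ 0) → (∀ i, Λ a' i ≠ 0) → θ (a * a') = θ a + θ a') ∧
      (∀ j, ∃ z : ℤ, θ (b j) = z) ∧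
      ∀ G : Set A, (∀ a ∈ G, ∃ z : ℤ, θ a = z) → (∀ a ∈ G, ∀ i, Λ a i ≠ 0) →
        ¬ {a | Λ a k = 1} ⊆ closure G := by
  have : ContinuousSMul ℝ A := IsScalarTower.continuousSMul ℂ
  have : FiniteDimensional ℝ A := Module.Finite.trans ℂ A
  cases nonempty_fintype ι
  obtain ⟨ψ, hψ, w, hw, hw0⟩ := exists_linearForm_integral (logSpace Λ k) hp
    (by have := finrank_logSpace hs k; rw [← Nat.card_eq_fintype_card] at this; omega) (fun j => reLog Λ s m (b j))
    fun j => reLog_mem_logSpace hs (hb j) (hbk j)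
  refine ⟨fun a => ψ (reLog Λ s m a), fun a a' ha ha' => ?_, hψ, fun G hG hGu hcl => hw0 ?_⟩
  · simp only [reLog_mul hs hnil ha ha', map_add]
  · refine linearForm_eq_zero_of_integral_reLog hs hm ψ (fun a ha hak => ?_) hw
    have hcont : ContinuousWithinAt (fun a => ψ (reLog Λ s m a)) G a :=
      (((ψ.continuous_of_finiteDimensional.comp_continuousOn continuousOn_reLog) a ha).mono hGu)
    -- Integrality passes from `G` to its limit points since `ℤ` is closed in `ℝ`.
    have h := hcont.mem_closure (hcl hak) (t := Set.range ((↑) : ℤ → ℝ))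
      fun x hx => by obtain ⟨z, hz⟩ := hG x hx; exact ⟨z, hz.symm⟩
    rw [Int.isClosedEmbedding_coe_real.isClosed_range.closure_eq] at h
    obtain ⟨z, hz⟩ := h
    exact ⟨z, hz.symm⟩

end SplitAlgebra

/-! ### Commuting block triangular matrices with a cyclic vector. -/

section BlockTriangular

open Matrix

theorem Matrix.mul_diag_of_lowerTriangular {N : ℕ} {M M' : Matrix (Fin N) (Fin N) ℂ}
    (h : ∀ i j, i < j → M i j = 0) (h' : ∀ i j, i < j → M' i j = 0) (i : Fin N) :
    (M * M') i i = M i i * M' i i := by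
  rw [Matrix.mul_apply]
  refine Finset.sum_eq_single_of_mem i (Finset.mem_univ i) fun j _ hj => ?_
  rcases lt_or_gt_of_ne hj with hj | hj
  · rw [h' _ _ hj, mul_zero]
  · rw [h _ _ hj, zero_mul]

/-- Cayley-Hamilton for the transpose, whose characteristic polynomial is `X ^ N`. -/
theorem Matrix.pow_eq_zero_of_strictly_lowerTriangular {N : ℕ} {M : Matrix (Fin N) (Fin N) ℂ}
    (h : ∀ i j, i < j → M i j = 0) (h0 : ∀ i, M i i = 0) : M ^ N = 0 := by
  have hT : Mᵀ.IsUpperTriangular := fun i j hij => h j i hij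
  have h1 := Matrix.aeval_self_charpoly Mᵀ
  rw [Matrix.charpoly_of_isUpperTriangular _ hT] at h1
  simpa [h0, ← Matrix.transpose_pow] using h1

variable {N : ℕ} {ι : Type*}

/-- The lower triangular matrices which are block diagonal for the partition of the indices into
the fibres of `β`, and whose diagonal entries are constant on these fibres. -/
def triangularSubalgebra (β : Fin N → ι) : Subalgebra ℂ (Matrix (Fin N) (Fin N) ℂ) where
  carrier := {M | (∀ i j, i < j → M i j = 0) ∧ (∀ i j, β i ≠ β j → M i j = 0) ∧
    ∀ i j, β i = β j → M i i = M j j}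
  mul_mem' := by
    rintro M M' ⟨h1, h2, h3⟩ ⟨h1', h2', h3'⟩
    refine ⟨fun i j hij => ?_, fun i j hij => ?_, fun i j hij => ?_⟩
    · rw [Matrix.mul_apply]
      refine Finset.sum_eq_zero fun k _ => ?_
      rcases lt_or_ge i k with hk | hk
      · rw [h1 _ _ hk, zero_mul]
      · rw [h1' _ _ (hk.trans_lt hij), mul_zero]
    · rw [Matrix.mul_apply]
      refine Finset.sum_eq_zero fun k _ => ?_
      by_cases hk : β i = β k
      · rw [h2' _ _ (hk ▸ hij), mul_zero]
      · rw [h2 _ _ hk, zero_mul]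
    · rw [mul_diag_of_lowerTriangular h1 h1', mul_diag_of_lowerTriangular h1 h1', h3 i j hij,
        h3' i j hij]
  add_mem' := by
    rintro M M' ⟨h1, h2, h3⟩ ⟨h1', h2', h3'⟩
    refine ⟨fun i j hij => ?_, fun i j hij => ?_, fun i j hij => ?_⟩
    · simp [h1 i j hij, h1' i j hij]
    · simp [h2 i j hij, h2' i j hij]
    · simp [h3 i j hij, h3' i j hij]
  algebraMap_mem' c := by
    refine ⟨fun i j hij => ?_, fun i j hij => ?_, fun i j _ => ?_⟩
    · exact Matrix.algebraMap_matrix_apply.trans (if_neg hij.ne)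
    · exact Matrix.algebraMap_matrix_apply.trans (if_neg fun h => hij (congrArg β h))
    · simp [Matrix.algebraMap_matrix_apply]

variable {β : Fin N → ι}

/-- The diagonal entries at given indices, as an algebra homomorphism. -/
def diagEntries (β : Fin N → ι) (σ : ι → Fin N) : triangularSubalgebra β →ₐ[ℂ] (ι → ℂ) where
  toFun M k := M.1 (σ k) (σ k)
  map_one' := by ext; simp
  map_zero' := by ext; simp
  map_add' _ _ := by ext; simp
  map_mul' M M' := by
    ext k
    exact mul_diag_of_lowerTriangular M.2.1 M'.2.1 _
  commutes' c := by ext; simp [Matrix.algebraMap_matrix_apply]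

/-- The diagonal matrices which are constant on the fibres of `β`. -/
def fibreDiagonal (β : Fin N → ι) : (ι → ℂ) →ₐ[ℂ] Matrix (Fin N) (Fin N) ℂ :=
  (Matrix.diagonalAlgHom ℂ).comp (AlgHom.pi fun i => Pi.evalAlgHom ℂ _ (β i))

theorem fibreDiagonal_apply (c : ι → ℂ) :
    fibreDiagonal β c = Matrix.diagonal fun i => c (β i) := rfl

theorem fibreDiagonal_mul_comm (c : ι → ℂ) {M : Matrix (Fin N) (Fin N) ℂ}
    (hM : M ∈ triangularSubalgebra β) : M * fibreDiagonal β c = fibreDiagonal β c * M := by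
  ext i j
  rw [fibreDiagonal_apply, Matrix.mul_diagonal, Matrix.diagonal_mul, mul_comm]
  by_cases h : β i = β j
  · rw [h]
  · rw [hM.2.1 i j h, mul_zero, mul_zero]

/-- Some `d` in the algebra agrees with `c` at `w`; both commute with the algebra, so they agree on
the orbit of `w` under it, which is everything. -/
theorem mem_adjoin_of_commute {S : Set (Matrix (Fin N) (Fin N) ℂ)} {w : Fin N → ℂ}
    (hw : ∀ x, ∃ M ∈ Algebra.adjoin ℂ S, M *ᵥ w = x)
    (hcomm : ∀ M ∈ S, ∀ M' ∈ S, M * M' = M' * M) {c : Matrix (Fin N) (Fin N) ℂ}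
    (hc : ∀ M ∈ S, M * c = c * M) : c ∈ Algebra.adjoin ℂ S := by
  have hcomm' (d : Matrix (Fin N) (Fin N) ℂ) (hd : ∀ M ∈ S, M * d = d * M) :
      ∀ M ∈ Algebra.adjoin ℂ S, M * d = d * M := fun M hM => by
    have : Algebra.adjoin ℂ S ≤ Subalgebra.centralizer ℂ {d} := Algebra.adjoin_le fun M hM =>
      Subalgebra.mem_centralizer_iff ℂ |>.2 fun g hg => by
        rw [Set.mem_singleton_iff.1 hg, hd M hM]
    exact ((Subalgebra.mem_centralizer_iff ℂ).1 (this hM) d rfl).symm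
  obtain ⟨d, hd, hdw⟩ := hw (c *ᵥ w)
  have hdS : ∀ M ∈ S, M * d = d * M := fun M hM =>
    (hcomm' M (fun M' hM' => hcomm M' hM' M hM) d hd).symm
  suffices c = d by rwa [this]
  refine Matrix.ext_of_mulVec_single fun i => ?_
  obtain ⟨M, hM, hMw⟩ := hw (Pi.single i 1)
  rw [← hMw, Matrix.mulVec_mulVec, Matrix.mulVec_mulVec, ← hcomm' c hc M hM, ← hcomm' d hdS M hM,
    ← Matrix.mulVec_mulVec, ← hdw, Matrix.mulVec_mulVec]

open scoped IsMulCommutative in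
/-- A commuting family `S` in the block triangular algebra, with `w` cyclic for `S`, carries a
homomorphism to `ℝ` which is integral at `p` given elements, and which is not integral on all of `S`
if the orbit of `w` is dense in an affine hyperplane. -/
theorem exists_hom_integral_orbit_not_dense {n : ℕ} [Finite ι] {β : Fin (n + 1) → ι}
    (hβ : Function.Surjective β)
    {S : Set (Matrix (Fin (n + 1)) (Fin (n + 1)) ℂ)} {w : Fin (n + 1) → ℂ}
    (hcyc : ∀ x, ∃ M ∈ Algebra.adjoin ℂ S, M *ᵥ w = x)
    (hcomm : ∀ M ∈ S, ∀ M' ∈ S, M * M' = M' * M)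
    (hS : S ⊆ triangularSubalgebra β) (hunit : ∀ M ∈ S, ∀ i, M i i ≠ 0)
    (hS0 : ∀ M ∈ S, M 0 0 = 1) (hw0 : w 0 = 1) {p : ℕ} (hp : 0 < p)
    (hcard : p + (Nat.card ι + 1) = 2 * (n + 1))
    (b : Fin p → Matrix (Fin (n + 1)) (Fin (n + 1)) ℂ) (hb : ∀ j, b j ∈ S) :
    ∃ θ : Matrix (Fin (n + 1)) (Fin (n + 1)) ℂ → ℝ,
      (∀ M ∈ S, ∀ M' ∈ S, θ (M * M') = θ M + θ M') ∧ (∀ j, ∃ z : ℤ, θ (b j) = z) ∧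
      ((∀ M ∈ S, ∃ z : ℤ, θ M = z) → ¬ {x | x 0 = 1} ⊆ closure ((· *ᵥ w) '' S)) := by
  classical
  set D := Algebra.adjoin ℂ S with hD
  have hDcomm : IsMulCommutative D := Algebra.isMulCommutative_adjoin ℂ hcomm
  have : IsTopologicalRing D := inferInstanceAs (IsTopologicalRing D.toSubring)
  have hSD : S ⊆ D := Algebra.subset_adjoin
  have hDK : D ≤ triangularSubalgebra β := Algebra.adjoin_le hS
  obtain ⟨σ, hσ⟩ := hβ.hasRightInverse
  let Λ : D →ₐ[ℂ] (ι → ℂ) := (diagEntries β σ).comp (Subalgebra.inclusion hDK)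
  let s : (ι → ℂ) →ₐ[ℂ] D := (fibreDiagonal β).codRestrict D fun c =>
    mem_adjoin_of_commute hcyc hcomm fun M hM => fibreDiagonal_mul_comm c (hS hM)
  have hΛ (M : D) (i) : Λ M (β i) = M.1 i i := (hDK M.2).2.2 _ _ (hσ (β i))
  have hs (c) : Λ (s c) = c := by
    ext k
    obtain ⟨i, rfl⟩ := hβ k
    rw [hΛ]
    exact Matrix.diagonal_apply_eq _ _
  have hnil (M : D) (hM : Λ M = 0) : M ^ (n + 1) = 0 := by
    refine Subtype.ext (Matrix.pow_eq_zero_of_strictly_lowerTriangular (hDK M.2).1 fun i => ?_)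
    rw [← hΛ, hM, Pi.zero_apply]
  let ev : D →ₗ[ℂ] (Fin (n + 1) → ℂ) :=
    { toFun M := M.1 *ᵥ w
      map_add' _ _ := Matrix.add_mulVec _ _ _
      map_smul' _ _ := Matrix.smul_mulVec _ _ _ }
  -- Cyclicity gives surjectivity; by commutativity, an `M` killing `w` kills every vector.
  have hev : Function.Bijective ev := by
    refine ⟨(injective_iff_map_eq_zero ev).2 fun M hM => Subtype.ext ?_, fun x => ?_⟩
    · refine Matrix.ext_of_mulVec_single fun i => ?_
      obtain ⟨M', hM', hMw⟩ := hcyc (Pi.single i 1)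
      have h : M.1 * M' = M' * M.1 := congrArg Subtype.val (mul_comm M ⟨M', hM'⟩)
      have hM0 : M.1 *ᵥ w = 0 := hM
      rw [← hMw, Matrix.mulVec_mulVec, h, ← Matrix.mulVec_mulVec, hM0, Matrix.mulVec_zero]
      exact (Matrix.zero_mulVec _).symm
    · obtain ⟨M, hM, hMw⟩ := hcyc x
      exact ⟨⟨M, hM⟩, hMw⟩
  let e := LinearEquiv.ofBijective ev hev
  have hfin : Module.finrank ℂ D = n + 1 := by simp [e.finrank_eq]
  have hu (M : D) (hM : M.1 ∈ S) (k) : Λ M k ≠ 0 := by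
    obtain ⟨i, rfl⟩ := hβ k
    rw [hΛ]
    exact hunit _ hM i
  obtain ⟨θ, hadd, hint, hdense⟩ := exists_hom_integral_not_dense hs hnil n.succ_pos (β 0) hp
    (by rw [hfin, hcard]) (fun j => ⟨b j, hSD (hb j)⟩) (fun j => hu _ (hb j))
    (fun j => (hΛ _ 0).trans (hS0 _ (hb j)))
  -- `θ` is extended by 0 outside `D`; only its values on `D` are used.
  have hθ {M} (hM : M ∈ D) : (if h : M ∈ D then θ ⟨M, h⟩ else 0) = θ ⟨M, hM⟩ := dif_pos hM
  refine ⟨fun M => if h : M ∈ D then θ ⟨M, h⟩ else 0, fun M hM M' hM' => ?_, fun j => ?_,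
    fun hz hcl => ?_⟩
  · simp only [hθ (hSD hM), hθ (hSD hM'), hθ (D.mul_mem (hSD hM) (hSD hM'))]
    exact hadd ⟨M, hSD hM⟩ ⟨M', hSD hM'⟩ (hu _ hM) (hu _ hM')
  · simpa only [hθ (hSD (hb j))] using hint j
  · refine hdense {M | M.1 ∈ S} (fun M hM => ?_) (fun M hM => hu M hM) fun M hM => ?_
    · simpa only [hθ M.2] using hz M.1 hM
    · have h0 : M.1 0 0 = 1 := (hΛ M 0).symm.trans hM
      have hM1 : e M ∈ closure ((· *ᵥ w) '' S) := by
        refine hcl ?_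
        change (M.1 *ᵥ w) 0 = 1
        rw [Matrix.mulVec, dotProduct, Finset.sum_eq_single_of_mem 0 (Finset.mem_univ _), h0, hw0,
          mul_one]
        intro j _ hj
        rw [(hDK M.2).1 0 j (Fin.pos_of_ne_zero hj), zero_mul]
      have hc : Continuous e.symm := e.symm.toLinearMap.continuous_of_finiteDimensional
      have := map_mem_closure hc hM1 (t := {M | M.1 ∈ S}) ?_
      · rwa [e.symm_apply_apply] at this
      · rintro _ ⟨M', hM', rfl⟩
        have : e ⟨M', hSD hM'⟩ = M' *ᵥ w := rfl
        simp only [← this, e.symm_apply_apply]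
        exact hM'

end BlockTriangular

/-! ### Affine maps as matrices, and generated semigroups. -/

namespace AbelianAffine

open Matrix

section Phi

variable {n : ℕ}

theorem apply_eq_add_linear (f : MA n) (x : Fin n → ℂ) : f x = f 0 + f.linear x := by
  conv_lhs => rw [f.decomp]
  exact add_comm _ _

theorem Phi_mulVec_cons (f : MA n) (c : ℂ) (x : Fin n → ℂ) :
    Phi f *ᵥ Fin.cons c x = Fin.cons c (c • f 0 + f.linear x) := by
  ext i
  refine Fin.cases ?_ (fun i => ?_) i
  · simp [Phi, Matrix.mulVec, dotProduct, Fin.sum_univ_succ]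
  · have h : (LinearMap.toMatrix' f.linear *ᵥ x) i = f.linear x i := by
      rw [LinearMap.toMatrix'_mulVec]
    rw [Matrix.mulVec, dotProduct] at h
    rw [Matrix.mulVec, dotProduct, Fin.sum_univ_succ]
    simp only [Phi, Matrix.of_apply, Fin.cons_zero, Fin.cons_succ, h, Pi.add_apply, Pi.smul_apply,
      smul_eq_mul, mul_comm c]

theorem Phi_mulVec_one_cons (f : MA n) (x : Fin n → ℂ) :
    Phi f *ᵥ Fin.cons 1 x = (Fin.cons 1 (f x) : Fin (n + 1) → ℂ) := by
  rw [Phi_mulVec_cons, one_smul, apply_eq_add_linear f x]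

theorem Phi_mul (f g : MA n) : Phi (f * g) = Phi f * Phi g := by
  refine Matrix.ext_of_mulVec_single fun i => ?_
  generalize (Pi.single i 1 : Fin (n + 1) → ℂ) = y
  rw [← Fin.cons_self_tail y, ← Matrix.mulVec_mulVec, Phi_mulVec_cons, Phi_mulVec_cons,
    Phi_mulVec_cons]
  congr 1
  change y 0 • f (g 0) + f.linear (g.linear _) = _
  rw [apply_eq_add_linear, map_add, map_smul, smul_add, add_assoc]

theorem Phi_one : Phi (1 : MA n) = 1 := by
  refine Matrix.ext_of_mulVec_single fun i => ?_
  generalize (Pi.single i 1 : Fin (n + 1) → ℂ) = y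
  rw [← Fin.cons_self_tail y, Phi_mulVec_cons, Matrix.one_mulVec]
  congr 1
  change y 0 • (0 : Fin n → ℂ) + Fin.tail y = _
  rw [smul_zero, zero_add]

theorem coe_mul (f g : GA n) : ((f * g : GA n) : MA n) = (f : MA n) * (g : MA n) := rfl

theorem coe_one : ((1 : GA n) : MA n) = 1 := rfl

theorem Phi_mul_Phi_inv (f : GA n) :
    Phi (f : MA n) * Phi ((f⁻¹ : GA n) : MA n) = 1 := by
  rw [← Phi_mul, ← coe_mul, mul_inv_cancel, coe_one, Phi_one]

theorem inv_Phi (f : GA n) : (Phi (f : MA n))⁻¹ = Phi ((f⁻¹ : GA n) : MA n) :=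
  Matrix.inv_eq_right_inv (Phi_mul_Phi_inv f)

end Phi

theorem mem_triangularSubalgebra_of_mem_K {N : ℕ} {η : Composition N}
    {M : Matrix (Fin N) (Fin N) ℂ} (hM : M ∈ K η) : M ∈ triangularSubalgebra η.index := by
  obtain ⟨B, hB, rfl⟩ := hM
  have key (i j : Fin N) : ∃ a b, i = η.blocksFinEquiv a ∧ j = η.blocksFinEquiv b ∧
      η.index i = a.1 ∧ η.index j = b.1 :=
    ⟨η.blocksFinEquiv.symm i, η.blocksFinEquiv.symm j, by simp, by simp, rfl, rfl⟩
  refine ⟨fun i j hij => ?_, fun i j hij => ?_, fun i j hij => ?_⟩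
  · obtain ⟨⟨k, a⟩, ⟨l, b⟩, rfl, rfl, -, -⟩ := key i j
    rw [Matrix.reindex_apply, Matrix.submatrix_apply, Equiv.symm_apply_apply,
      Equiv.symm_apply_apply]
    by_cases h : k = l
    · subst h
      rw [Matrix.blockDiagonal'_apply_eq]
      exact (hB k).1 a b ((η.embedding k).lt_iff_lt.1 hij)
    · exact Matrix.blockDiagonal'_apply_ne _ _ _ h
  · obtain ⟨⟨k, a⟩, ⟨l, b⟩, rfl, rfl, h1, h2⟩ := key i j
    rw [Matrix.reindex_apply, Matrix.submatrix_apply, Equiv.symm_apply_apply,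
      Equiv.symm_apply_apply]
    exact Matrix.blockDiagonal'_apply_ne _ _ _ (by rwa [h1, h2] at hij)
  · obtain ⟨⟨k, a⟩, ⟨l, b⟩, rfl, rfl, h1, h2⟩ := key i j
    obtain rfl : k = l := by rwa [h1, h2] at hij
    simp only [Matrix.reindex_apply, Matrix.submatrix_apply, Equiv.symm_apply_apply,
      Matrix.blockDiagonal'_apply_eq]
    obtain ⟨μ, hμ⟩ := (hB k).2
    rw [hμ, hμ]

theorem index_surjective {N : ℕ} (η : Composition N) : Function.Surjective η.index := fun k =>
  ⟨η.embedding k ⟨0, η.one_le_blocksFun k⟩, η.index_embedding _ _⟩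

namespace IsGeneratedBy

variable {n p : ℕ} {𝒢 : Subsemigroup (MA n)} {f : Fin p → GA n}

theorem mem (h : IsGeneratedBy 𝒢 f) (k : Fin p) : ((f k : GA n) : MA n) ∈ 𝒢 := by
  rcases h with rfl | rfl | h
  · exact Subsemigroup.subset_closure ⟨k, rfl⟩
  · exact Submonoid.subset_closure ⟨k, rfl⟩
  · rw [← SetLike.mem_coe, h]
    exact ⟨f k, Subgroup.subset_closure ⟨k, rfl⟩, rfl⟩

/-- Handles the three kinds of generation at once: commutativity and invertibility are inherited
from the group. -/
theorem exists_mem_closure (h : IsGeneratedBy 𝒢 f) {g : MA n} (hg : g ∈ 𝒢) :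
    ∃ γ ∈ Subgroup.closure (Set.range f), (γ : MA n) = g := by
  rcases h with rfl | rfl | h
  · induction hg using Subsemigroup.closure_induction with
    | mem x hx =>
      obtain ⟨k, rfl⟩ := hx
      exact ⟨f k, Subgroup.subset_closure ⟨k, rfl⟩, rfl⟩
    | mul x y _ _ hx hy =>
      obtain ⟨a, ha, rfl⟩ := hx
      obtain ⟨b, hb, rfl⟩ := hy
      exact ⟨a * b, mul_mem ha hb, rfl⟩
  · change g ∈ Submonoid.closure _ at hg
    induction hg using Submonoid.closure_induction with
    | mem x hx =>
      obtain ⟨k, rfl⟩ := hx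
      exact ⟨f k, Subgroup.subset_closure ⟨k, rfl⟩, rfl⟩
    | one => exact ⟨1, one_mem _, rfl⟩
    | mul x y _ _ hx hy =>
      obtain ⟨a, ha, rfl⟩ := hx
      obtain ⟨b, hb, rfl⟩ := hy
      exact ⟨a * b, mul_mem ha hb, rfl⟩
  · rw [← SetLike.mem_coe, h] at hg
    exact hg

theorem mul_comm (h : IsGeneratedBy 𝒢 f) (hf : ∀ i j, f i * f j = f j * f i) {g g' : MA n}
    (hg : g ∈ 𝒢) (hg' : g' ∈ 𝒢) : g * g' = g' * g := by
  obtain ⟨a, ha, rfl⟩ := h.exists_mem_closure hg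
  obtain ⟨b, hb, rfl⟩ := h.exists_mem_closure hg'
  have := Subgroup.isMulCommutative_closure (k := Set.range f)
    (by rintro _ ⟨i, rfl⟩ _ ⟨j, rfl⟩; exact hf i j)
  rw [← coe_mul, ← coe_mul, setLike_mul_comm ha hb]

/-- An additive function on `𝒢` with integer values at the generators has integer values. -/
theorem integral (h : IsGeneratedBy 𝒢 f) {θ : MA n → ℝ}
    (hθ : ∀ g ∈ 𝒢, ∀ g' ∈ 𝒢, θ (g * g') = θ g + θ g') (hf : ∀ k, ∃ z : ℤ, θ (f k) = z)
    {g : MA n} (hg : g ∈ 𝒢) : ∃ z : ℤ, θ g = z := by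
  have hmul {x y : MA n} (hx : x ∈ 𝒢) (hy : y ∈ 𝒢) (h1 : ∃ z : ℤ, θ x = z)
      (h2 : ∃ z : ℤ, θ y = z) : ∃ z : ℤ, θ (x * y) = z := by
    obtain ⟨z, hz⟩ := h1
    obtain ⟨z', hz'⟩ := h2
    exact ⟨z + z', by rw [hθ x hx y hy, hz, hz', Int.cast_add]⟩
  have hone (h1 : (1 : MA n) ∈ 𝒢) : θ 1 = 0 := by
    have := hθ 1 h1 1 h1
    rw [mul_one] at this
    linarith
  rcases h with rfl | rfl | h
  · induction hg using Subsemigroup.closure_induction with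
    | mem x hx =>
      obtain ⟨k, rfl⟩ := hx
      exact hf k
    | mul x y hx hy h1 h2 => exact hmul hx hy h1 h2
  · change g ∈ Submonoid.closure _ at hg
    induction hg using Submonoid.closure_induction with
    | mem x hx =>
      obtain ⟨k, rfl⟩ := hx
      exact hf k
    | one => exact ⟨0, by rw [hone (one_mem (Submonoid.closure _)), Int.cast_zero]⟩
    | mul x y hx hy h1 h2 => exact hmul hx hy h1 h2
  · have hmem {γ : GA n} (hγ : γ ∈ Subgroup.closure (Set.range f)) : (γ : MA n) ∈ 𝒢 := by
      rw [← SetLike.mem_coe, h]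
      exact ⟨γ, hγ, rfl⟩
    rw [← SetLike.mem_coe, h] at hg
    obtain ⟨γ, hγ, rfl⟩ := hg
    change ∃ z : ℤ, θ (γ : MA n) = z
    induction hγ using Subgroup.closure_induction with
    | mem x hx =>
      obtain ⟨k, rfl⟩ := hx
      exact hf k
    | one => exact ⟨0, by rw [coe_one, hone (hmem (one_mem _)), Int.cast_zero]⟩
    | mul x y hx hy h1 h2 => exact hmul (hmem hx) (hmem hy) h1 h2
    | inv x hx h1 =>
      obtain ⟨z, hz⟩ := h1
      have := hθ _ (hmem hx) _ (hmem (inv_mem hx))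
      rw [← coe_mul, mul_inv_cancel, coe_one, hone (hmem (one_mem _)), hz] at this
      exact ⟨-z, by rw [Int.cast_neg]; linarith⟩

end IsGeneratedBy

/-- If the vectors `M *ᵥ w`, `M ∈ S`, are dense in an affine hyperplane not containing `0`, then `w`
is cyclic for the algebra generated by `S`. -/
theorem exists_mem_adjoin_mulVec_eq {n : ℕ} {S : Set (Matrix (Fin (n + 1)) (Fin (n + 1)) ℂ)}
    {w : Fin (n + 1) → ℂ} (h : {x | x 0 = 1} ⊆ closure ((· *ᵥ w) '' S)) (x : Fin (n + 1) → ℂ) :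
    ∃ M ∈ Algebra.adjoin ℂ S, M *ᵥ w = x := by
  let E : Submodule ℂ (Fin (n + 1) → ℂ) :=
    (Subalgebra.toSubmodule (Algebra.adjoin ℂ S)).map ((Matrix.mulVecBilin ℂ ℂ).flip w)
  have hE : IsClosed (E : Set (Fin (n + 1) → ℂ)) := E.closed_of_finiteDimensional
  have h1 : ∀ y : Fin (n + 1) → ℂ, y 0 = 1 → y ∈ E := fun y hy => by
    refine closure_minimal ?_ hE (h hy)
    rintro _ ⟨M, hM, rfl⟩
    exact ⟨M, Algebra.subset_adjoin hM, rfl⟩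
  have h2 : x ∈ E := by
    -- Both terms are multiples of vectors with 0th coordinate 1, so the hyperplane spans the space.
    have : x = (x + (1 - x 0) • Pi.single 0 1) - (1 - x 0) • Pi.single 0 1 := by abel
    rw [this]
    exact E.sub_mem (h1 _ (by simp)) (E.smul_mem _ (h1 _ (by simp)))
  obtain ⟨M, hM, hMx⟩ := h2
  exact ⟨M, hM, hMx⟩

end AbelianAffine

open AbelianAffine Matrix in
theorem corollary1p3 (n : ℕ) (hn : 1 ≤ n)
    (𝒢 : Subsemigroup (AbelianAffine.MA n))
    (P : Matrix (Fin (n + 1)) (Fin (n + 1)) ℂ)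
    (hP : ∃ φ : AbelianAffine.GA n, P = AbelianAffine.Phi (φ : AbelianAffine.MA n))
    (η : Composition (n + 1)) (r : ℕ) (hr : η.length = r)
    (hnormal : ∀ g ∈ 𝒢, P⁻¹ * AbelianAffine.Phi g * P ∈ AbelianAffine.K η)
    (f : Fin (2 * n + 1 - r) → AbelianAffine.GA n)
    (hcomm : ∀ i j, f i * f j = f j * f i)
    (hgen : AbelianAffine.IsGeneratedBy 𝒢 f) :
    ¬ ∃ v : Fin n → ℂ, Dense (AbelianAffine.orbit 𝒢 v) := by
  rintro ⟨v, hv⟩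
  obtain ⟨φ, rfl⟩ := hP
  let c : MA n → MA n := fun g => ((φ⁻¹ : GA n) : MA n) * g * (φ : MA n)
  have hφ : (φ : MA n) * ((φ⁻¹ : GA n) : MA n) = 1 := by
    rw [← coe_mul, mul_inv_cancel, coe_one]
  have hc (g g' : MA n) : c (g * g') = c g * c g' := by
    simp only [c, mul_assoc]
    rw [← mul_assoc (φ : MA n), hφ, one_mul]
  have hcK (g : MA n) (hg : g ∈ 𝒢) : Phi (c g) ∈ triangularSubalgebra η.index := by
    rw [Phi_mul, Phi_mul, ← inv_Phi]
    exact mem_triangularSubalgebra_of_mem_K (hnormal g hg)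
  set S : Set (Matrix (Fin (n + 1)) (Fin (n + 1)) ℂ) := (fun g => Phi (c g)) '' (𝒢 : Set (MA n))
    with hS
  set w : Fin (n + 1) → ℂ := Fin.cons 1 ((φ⁻¹ : GA n) v) with hw
  have hdense : {x | x 0 = 1} ⊆ closure ((· *ᵥ w) '' S) := by
    intro x (hx : x 0 = 1)
    obtain ⟨y, rfl⟩ : ∃ y : Fin n → ℂ, x = Fin.cons 1 y :=
      ⟨fun i => x i.succ, by rw [← hx]; exact (Fin.cons_self_tail x).symm⟩
    have hcont : Continuous fun y : Fin n → ℂ => (Fin.cons 1 ((φ⁻¹ : GA n) y) : Fin (n + 1) → ℂ) :=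
      continuous_const.finCons ((φ⁻¹ : GA n) : MA n).continuous_of_finiteDimensional
    have hy : (φ⁻¹ : GA n) (φ y) = y := φ.symm_apply_apply y
    rw [← hy]
    refine map_mem_closure (f := fun y => (Fin.cons 1 ((φ⁻¹ : GA n) y) : Fin (n + 1) → ℂ)) hcont
      (hv (φ y)) ?_
    rintro _ ⟨g, hg, rfl⟩
    refine ⟨_, ⟨g, hg, rfl⟩, ?_⟩
    have : (φ : MA n) ((φ⁻¹ : GA n) v) = v := φ.apply_symm_apply v
    change Phi (c g) *ᵥ w = _
    rw [hw, Phi_mulVec_one_cons]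
    change (Fin.cons 1 ((φ⁻¹ : GA n) (g ((φ : MA n) ((φ⁻¹ : GA n) v)))) : Fin (n + 1) → ℂ) = _
    rw [this]
  -- This makes the truncated subtraction `2 * n + 1 - r` exact and, with `hn`, positive.
  have hlen : η.length ≤ n + 1 := η.length_le
  obtain ⟨θ, hadd, hint, hnot⟩ := exists_hom_integral_orbit_not_dense (index_surjective η)
    (S := S) (w := w) (p := 2 * n + 1 - r) (exists_mem_adjoin_mulVec_eq hdense)
    (by
      rintro _ ⟨g, hg, rfl⟩ _ ⟨g', hg', rfl⟩
      simp only [← Phi_mul, ← hc, hgen.mul_comm hcomm hg hg'])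
    (by rintro _ ⟨g, hg, rfl⟩; exact hcK g hg)
    (by
      rintro _ ⟨g, hg, rfl⟩ i hi
      obtain ⟨γ, -, rfl⟩ := hgen.exists_mem_closure hg
      -- The determinant of a triangular matrix is the product of its diagonal entries, so none of
      -- them vanishes.
      have h1 : (Phi (c γ)).det ≠ 0 := by
        have := congrArg Matrix.det (Phi_mul_Phi_inv (φ⁻¹ * γ * φ))
        rw [Matrix.det_mul, Matrix.det_one] at this
        exact left_ne_zero_of_mul_eq_one this
      rw [Matrix.det_of_isLowerTriangular _ fun i j hij => (hcK _ hg).1 i j hij] at h1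
      exact h1 (Finset.prod_eq_zero (Finset.mem_univ i) hi))
    (by rintro _ ⟨g, hg, rfl⟩; rfl) rfl (by omega) (by simp only [Nat.card_fin]; omega)
    (fun j => Phi (c (f j))) fun j => ⟨_, hgen.mem j, rfl⟩
  refine hnot ?_ hdense
  rintro _ ⟨g, hg, rfl⟩
  refine hgen.integral (θ := fun g => θ (Phi (c g))) (fun g hg g' hg' => ?_) hint hg
  rw [hc, Phi_mul]
  exact hadd _ ⟨g, hg, rfl⟩ _ ⟨g', hg', rfl⟩
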